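/- Let $\sigma_1>0$ and $0<r\le r_c$, where $r_c=\tfrac43$, and consider in $(x,p,y)$-space $\mathbb{R}^3$ the most-probable-path (Hamiltonian/Euler--Lagrange) system $$\dot x=(x+y)^2-1+\sigma_1^2p,\qquad \dot p=-2(x+y)p,\qquad \dot y=ry(3-y).$$ The points $s_1=(-1,0,0)$ and $s_2=(-2,0,3)$ are saddle equilibria (equilibria whose linearization has no eigenvalue on the imaginary axis, and has eigenvalues both with negative and with positive real part), and the system has a heteroclinic orbit from $s_1$ to $s_2$, that is, a solution $(x(t),p(t),y(t))$ defined for all $t\in\mathbb{R}$ which tends to $s_1$ as $t\to-\infty$ and to $s_2$ as $t\to+\infty$. This orbit crosses the plane $y=-x$ at $y=\tfrac32$: for some $t_0$ one has $x(t_0)=-\tfrac32$ and $y(t_0)=\tfrac32$, while $x(t)+y(t)<0$ for $t<t_0$ and $x(t)+y(t)>0$ for $t>t_0$. -/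

import Mathlib

open Filter Topology

/-- The most-probable-path vector field, on the phase space with coordinates
`v 0 = x`, `v 1 = p`, `v 2 = y`:
`x' = (x + y)^2 - 1 + σ₁^2 p`, `p' = -2 (x + y) p`, `y' = r y (3 - y)`. -/
def mppField (r σ₁ : ℝ) (v : Fin 3 → ℝ) : Fin 3 → ℝ :=
  ![(v 0 + v 2) ^ 2 - 1 + σ₁ ^ 2 * v 1, -2 * (v 0 + v 2) * v 1, r * v 2 * (3 - v 2)]

/-- `a` is a saddle of `v' = F v`: an equilibrium whose linearization has no (complex) eigenvalue
on the imaginary axis, at least one with negative and at least one with positive real part. -/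
structure IsSaddle {n : ℕ} (F : (Fin n → ℝ) → (Fin n → ℝ)) (a : Fin n → ℝ) : Prop where
  equilibrium : F a = 0
  differentiableAt : DifferentiableAt ℝ F a
  hyperbolic : ∀ z ∈ (fderiv ℝ F a).toLinearMap.charpoly.aroots ℂ, z.re ≠ 0
  exists_stable : ∃ z ∈ (fderiv ℝ F a).toLinearMap.charpoly.aroots ℂ, z.re < 0
  exists_unstable : ∃ z ∈ (fderiv ℝ F a).toLinearMap.charpoly.aroots ℂ, 0 < z.re

/-- `γ` is a heteroclinic orbit of `v' = F v` from the equilibrium `a` to the different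
equilibrium `b`: a solution on all of `ℝ` tending to `a` as `t → -∞` and to `b` as `t → +∞`. -/
structure IsHeteroclinicOrbit {n : ℕ} (F : (Fin n → ℝ) → (Fin n → ℝ)) (a b : Fin n → ℝ)
    (γ : ℝ → (Fin n → ℝ)) : Prop where
  ne : a ≠ b
  left_equilibrium : F a = 0
  right_equilibrium : F b = 0
  solution : ∀ t : ℝ, HasDerivAt γ (F (γ t)) t
  tendsto_left : Tendsto γ atBot (𝓝 a)
  tendsto_right : Tendsto γ atTop (𝓝 b)

/-! Put `w = x + y`, absorb `σ₁ ^ 2` into `p`, and let `y` be the logistic solution with `y 0 = 3 /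
2`. The system becomes `w' = w² - 1 + p + f`, `p' = -2wp`, with `f = ry(3 - y)` even in time. It is
invariant under `(w, p, t) ↦ (-w, p, -t)`, so an orbit on `t ≥ 0` from `w = 0` to `(1, 0)` extends
by reflection (`IsHalfOrbit.isFullOrbit`).

For `r < 4 / 3` such an orbit is found by shooting in `q = p 0`. For `q = 0` comparison with the
profile `2y / 3 - 1` forces `w` below `0` (`IsTruncSol.exists_neg`); for large `q` it passes `1`
(`IsTruncSol.one_lt_of_large`). Both exits are open in `q` and exclude each other, since the source
`p + f` decreases, so by connectedness some `q` keeps `w` in `[0, 1]`. Then `w` increases, `p`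
decays and `w → 1`. At `r = 4 / 3` the profile with `p = 0` is itself the orbit.

Truncating `w` to `[0, 2]` gives global solutions and is invisible on orbits in `[0, 1]`. -/

/-! ### Global solutions of bounded Lipschitz equations -/

/-- A bounded, globally Lipschitz time-dependent vector field has global integral curves. -/
theorem exists_hasDerivAt_of_lipschitzWith_of_norm_le {E : Type*} [NormedAddCommGroup E]
    [NormedSpace ℝ E] [CompleteSpace E] {v : ℝ → E → E} {K L : NNReal}
    (hv : ∀ t, LipschitzWith K (v t)) (hc : ∀ x, Continuous fun t ↦ v t x)
    (hL : ∀ t x, ‖v t x‖ ≤ L) (x₀ : E) :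
    ∃ α : ℝ → E, α 0 = x₀ ∧ ∀ t, HasDerivAt α (v t (α t)) t := by
  have local_sol (n : ℕ) : ∃ α : ℝ → E, α 0 = x₀ ∧
      ∀ t ∈ Set.Ioo (-(n + 1 : ℝ)) (n + 1), HasDerivAt α (v t (α t)) t := by
    have h0 : (0 : ℝ) ∈ Set.Icc (-(n + 1 : ℝ)) (n + 1) := by
      constructor <;> linarith [n.cast_nonneg (α := ℝ)]
    -- A curve of speed at most `L` stays within `L * (n + 1)` of `x₀` on this interval, so no
    -- shrinking is needed.
    have hPL : IsPicardLindelof v (⟨0, h0⟩ : Set.Icc (-(n + 1 : ℝ)) (n + 1)) x₀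
        (L * (n + 1)) 0 L K :=
      { lipschitzOnWith := fun t _ ↦ (hv t).lipschitzOnWith
        continuousOn := fun x _ ↦ (hc x).continuousOn
        norm_le := fun t _ x _ ↦ hL t x
        mul_max_le := by simp }
    obtain ⟨α, h1, h2⟩ := hPL.exists_eq_forall_mem_Icc_hasDerivWithinAt₀
    exact ⟨α, h1, fun t ht ↦ (h2 t (Set.Ioo_subset_Icc_self ht)).hasDerivAt
      (Icc_mem_nhds ht.1 ht.2)⟩
  choose α hα0 hα using local_sol
  have agree (m n : ℕ) (hmn : m ≤ n) :
      Set.EqOn (α m) (α n) (Set.Ioo (-(m + 1 : ℝ)) (m + 1)) := by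
    have hmn' : (m : ℝ) ≤ n := by exact_mod_cast hmn
    have hm : (0 : ℝ) ≤ m := m.cast_nonneg
    refine ODE_solution_unique_of_mem_Ioo (s := fun _ ↦ Set.univ) (t₀ := 0) (K := K)
      (fun t _ ↦ (hv t).lipschitzOnWith) ⟨by linarith, by linarith⟩
      (fun t ht ↦ ⟨hα m t ht, trivial⟩)
      (fun t ht ↦ ⟨hα n t ⟨by linarith [ht.1], by linarith [ht.2]⟩, trivial⟩)
      ((hα0 m).trans (hα0 n).symm)
  refine ⟨fun t ↦ α ⌈|t|⌉₊ t, by simpa using hα0 0, fun t ↦ ?_⟩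
  set N := ⌈|t|⌉₊ with hN
  have mem (s : ℝ) : s ∈ Set.Ioo (-((⌈|s|⌉₊ : ℕ) + 1 : ℝ)) ((⌈|s|⌉₊ : ℕ) + 1) := by
    have := Nat.le_ceil |s|
    exact abs_lt.1 (by linarith)
  refine (hα N t (mem t)).congr_of_eventuallyEq ?_
  filter_upwards [Ioo_mem_nhds (mem t).1 (mem t).2] with s hs
  rcases le_total ⌈|s|⌉₊ N with h | h
  · exact agree _ _ h (mem s)
  · exact (agree _ _ h hs).symm

/-! ### The truncated forced system -/

/-- Truncation of a real number to the interval `[0, 2]`. -/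
noncomputable def clip (w : ℝ) : ℝ := max 0 (min w 2)

theorem clip_nonneg (w : ℝ) : 0 ≤ clip w := le_max_left _ _

theorem clip_le_two (w : ℝ) : clip w ≤ 2 := max_le (by norm_num) (min_le_right _ _)

theorem clip_of_nonpos {w : ℝ} (h : w ≤ 0) : clip w = 0 :=
  max_eq_left ((min_le_left _ _).trans h)

theorem clip_of_mem {w : ℝ} (h0 : 0 ≤ w) (h1 : w ≤ 2) : clip w = w := by
  rw [clip, min_eq_left h1, max_eq_right h0]

theorem one_le_clip {w : ℝ} (h : 1 ≤ w) : 1 ≤ clip w :=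
  (le_min h (by norm_num)).trans (le_max_right _ _)

theorem abs_clip_sub_clip_le (a b : ℝ) : |clip a - clip b| ≤ |a - b| := by
  unfold clip
  refine (abs_max_sub_max_le_max _ _ _ _).trans (max_le (by simp) ?_)
  exact (abs_min_sub_min_le_max _ _ _ _).trans (max_le le_rfl (by simp))

theorem abs_exp_sub_exp_le {a b : ℝ} (ha : a ≤ 0) (hb : b ≤ 0) :
    |Real.exp a - Real.exp b| ≤ |a - b| := by
  wlog h : b ≤ a generalizing a b
  · rw [abs_sub_comm, abs_sub_comm a]; exact this hb ha (le_of_not_ge h)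
  rw [abs_of_nonneg (sub_nonneg.2 (Real.exp_le_exp.2 h)), abs_of_nonneg (sub_nonneg.2 h)]
  have h1 := Real.add_one_le_exp (b - a)
  have h2 : Real.exp b = Real.exp a * Real.exp (b - a) := by rw [← Real.exp_add]; ring_nf
  have h3 : Real.exp a ≤ 1 := Real.exp_le_one_iff.2 ha
  have h4 := Real.exp_pos a
  nlinarith

/-- A positive forcing term which decreases to `0` on the positive half-line. -/
structure IsDecayingForcing (f : ℝ → ℝ) : Prop where
  continuous : Continuous f
  pos : ∀ t, 0 < f t
  bounded : ∃ M, ∀ t, f t ≤ M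
  strictAntiOn : StrictAntiOn f (Set.Ici 0)
  tendsto : Tendsto f atTop (𝓝 0)

/-- The momentum `q e^{-2 s⁺}` at accumulated drift `s`. -/
noncomputable def momentum (q s : ℝ) : ℝ := q * Real.exp (-2 * max s 0)

theorem momentum_nonneg {q : ℝ} (hq : 0 ≤ q) (s : ℝ) : 0 ≤ momentum q s :=
  mul_nonneg hq (Real.exp_pos _).le

theorem momentum_le {q : ℝ} (hq : 0 ≤ q) (s : ℝ) : momentum q s ≤ q :=
  mul_le_of_le_one_right hq (Real.exp_le_one_iff.2 (by linarith [le_max_right s 0]))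

theorem momentum_antitone {q : ℝ} (hq : 0 ≤ q) : Antitone (momentum q) := fun a b h ↦ by
  unfold momentum
  have : max a 0 ≤ max b 0 := max_le_max_right _ h
  gcongr ?_ * Real.exp ?_
  linarith

theorem abs_momentum_sub_momentum_le {q : ℝ} (hq : 0 ≤ q) (a b : ℝ) :
    |momentum q a - momentum q b| ≤ 2 * q * |a - b| := by
  have h := abs_exp_sub_exp_le (a := -2 * max a 0) (b := -2 * max b 0)
    (by linarith [le_max_right a 0]) (by linarith [le_max_right b 0])
  have h2 : |max a 0 - max b 0| ≤ |a - b| :=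
    (abs_max_sub_max_le_max _ _ _ _).trans (max_le le_rfl (by simp))
  rw [← mul_sub, abs_mul, abs_neg, abs_two] at h
  unfold momentum
  rw [← mul_sub, abs_mul, abs_of_nonneg hq]
  calc q * _ ≤ q * (2 * |a - b|) := by gcongr; linarith
    _ = _ := by ring

/-- The reduced vector field in the coordinates `(w, s)`, truncated so as to be bounded and
globally Lipschitz. -/
noncomputable def truncField (f : ℝ → ℝ) (q t : ℝ) (z : ℝ × ℝ) : ℝ × ℝ :=
  (clip z.1 ^ 2 - 1 + momentum q z.2 + f t, clip z.1)

theorem lipschitzWith_truncField (f : ℝ → ℝ) {q : ℝ} (hq : 0 ≤ q) (t : ℝ) :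
    LipschitzWith (4 + 2 * q).toNNReal (truncField f q t) := by
  refine LipschitzWith.of_dist_le_mul fun x y ↦ ?_
  rw [Real.coe_toNNReal _ (by linarith)]
  have h1 : |x.1 - y.1| ≤ dist x y := le_max_left _ _
  have h2 : |x.2 - y.2| ≤ dist x y := le_max_right _ _
  have hc := abs_clip_sub_clip_le x.1 y.1
  have hd : 0 ≤ dist x y := dist_nonneg
  refine max_le ?_ ?_
  · have hm := abs_momentum_sub_momentum_le hq x.2 y.2
    have hs : |clip x.1 ^ 2 - clip y.1 ^ 2| ≤ 4 * |x.1 - y.1| := by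
      rw [sq_sub_sq, abs_mul, abs_of_nonneg (add_nonneg (clip_nonneg _) (clip_nonneg _))]
      exact mul_le_mul (by linarith [clip_le_two x.1, clip_le_two y.1]) hc (abs_nonneg _)
        (by norm_num)
    simp only [truncField, Real.dist_eq]
    rw [show clip x.1 ^ 2 - 1 + momentum q x.2 + f t - (clip y.1 ^ 2 - 1 + momentum q y.2 + f t)
      = (clip x.1 ^ 2 - clip y.1 ^ 2) + (momentum q x.2 - momentum q y.2) by ring]
    refine (abs_add_le _ _).trans ?_
    nlinarith [abs_nonneg (x.2 - y.2)]
  · simp only [truncField, Real.dist_eq]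
    nlinarith

/-- `(W, S)` solves the truncated reduced system with initial value `(0, 0)`. -/
structure IsTruncSol (f : ℝ → ℝ) (q : ℝ) (W S : ℝ → ℝ) : Prop where
  W_zero : W 0 = 0
  S_zero : S 0 = 0
  W_deriv : ∀ t, HasDerivAt W (clip (W t) ^ 2 - 1 + momentum q (S t) + f t) t
  S_deriv : ∀ t, HasDerivAt S (clip (W t)) t

theorem IsDecayingForcing.exists_isTruncSol {f : ℝ → ℝ} (hf : IsDecayingForcing f) {q : ℝ}
    (hq : 0 ≤ q) : ∃ W S, IsTruncSol f q W S := by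
  obtain ⟨M, hM⟩ := hf.bounded
  have hM0 : 0 < M := (hf.pos 0).trans_le (hM 0)
  obtain ⟨α, h0, hα⟩ := exists_hasDerivAt_of_lipschitzWith_of_norm_le
    (v := truncField f q) (L := (5 + q + M).toNNReal)
    (lipschitzWith_truncField f hq)
    (fun x ↦ by have := hf.continuous; unfold truncField; fun_prop)
    (fun t x ↦ by
      rw [Real.coe_toNNReal _ (by linarith)]
      have c0 := clip_nonneg x.1
      have c2 := clip_le_two x.1
      refine max_le ?_ ?_
      · have := momentum_nonneg hq x.2
        have := momentum_le hq x.2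
        have := hf.pos t
        have := hM t
        simp only [truncField, Real.norm_eq_abs, abs_le]
        constructor <;> nlinarith
      · simp only [truncField, Real.norm_eq_abs, abs_of_nonneg c0]
        linarith)
    ((0, 0) : ℝ × ℝ)
  exact ⟨fun t ↦ (α t).1, fun t ↦ (α t).2, by simp [h0], by simp [h0],
    fun t ↦ (ContinuousLinearMap.fst ℝ ℝ ℝ).hasFDerivAt.comp_hasDerivAt t (hα t),
    fun t ↦ (ContinuousLinearMap.snd ℝ ℝ ℝ).hasFDerivAt.comp_hasDerivAt t (hα t)⟩

/-! ### Traps and asymptotics of truncated solutions -/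

namespace IsTruncSol

variable {f : ℝ → ℝ} {q : ℝ} {W S : ℝ → ℝ}

theorem W_continuous (h : IsTruncSol f q W S) : Continuous W :=
  continuous_iff_continuousAt.2 fun t ↦ (h.W_deriv t).continuousAt

theorem S_continuous (h : IsTruncSol f q W S) : Continuous S :=
  continuous_iff_continuousAt.2 fun t ↦ (h.S_deriv t).continuousAt

theorem S_monotone (h : IsTruncSol f q W S) : Monotone S :=
  monotone_of_hasDerivAt_nonneg h.S_deriv fun t ↦ clip_nonneg (W t)

theorem S_nonneg (h : IsTruncSol f q W S) {t : ℝ} (ht : 0 ≤ t) : 0 ≤ S t :=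
  h.S_zero ▸ h.S_monotone ht

theorem strictAntiOn_source (h : IsTruncSol f q W S) (hf : IsDecayingForcing f) (hq : 0 ≤ q) :
    StrictAntiOn (fun t ↦ momentum q (S t) + f t) (Set.Ici 0) := fun _ ha _ hb hab ↦
  add_lt_add_of_le_of_lt (momentum_antitone hq (h.S_monotone hab.le)) (hf.strictAntiOn ha hb hab)

/-- As long as the source exceeds `1`, the solution increases strictly. -/
theorem strictMonoOn_of_source (h : IsTruncSol f q W S) (hf : IsDecayingForcing f) (hq : 0 ≤ q)
    {t₁ : ℝ} (ht : 1 ≤ momentum q (S t₁) + f t₁) : StrictMonoOn W (Set.Icc 0 t₁) := by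
  refine strictMonoOn_of_hasDerivWithinAt_pos (convex_Icc _ _) h.W_continuous.continuousOn
    (fun t _ ↦ (h.W_deriv t).hasDerivWithinAt) fun t ht' ↦ ?_
  rw [interior_Icc] at ht'
  have h0 : (0 : ℝ) ≤ t₁ := (ht'.1.trans ht'.2).le
  have := h.strictAntiOn_source hf hq (Set.mem_Ici.2 ht'.1.le) (Set.mem_Ici.2 h0) ht'.2
  have := sq_nonneg (clip (W t))
  simp only at *
  linarith

/-- The source decreases, so if it were still at least `1` at `t₁`, then `W` would have risen
strictly from `0`. -/
theorem source_lt_one (h : IsTruncSol f q W S) (hf : IsDecayingForcing f) (hq : 0 ≤ q)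
    {t₁ : ℝ} (ht : 0 < t₁) (hW : W t₁ ≤ 0) : momentum q (S t₁) + f t₁ < 1 := by
  by_contra! hc
  have := h.strictMonoOn_of_source hf hq hc (Set.left_mem_Icc.2 ht.le)
    (Set.right_mem_Icc.2 ht.le) ht
  rw [h.W_zero] at this
  linarith

/-- At a negative level the truncated square vanishes and the source stays below `1`, so `W` can
only cross downwards. -/
theorem le_of_neg (h : IsTruncSol f q W S) (hf : IsDecayingForcing f) (hq : 0 ≤ q)
    {t₁ t : ℝ} (ht : 0 < t₁) (hW : W t₁ < 0) (htt : t₁ ≤ t) : W t ≤ W t₁ := by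
  have h1 := h.source_lt_one hf hq ht hW.le
  refine image_le_of_deriv_right_lt_deriv_boundary (B := fun _ ↦ W t₁) (B' := fun _ ↦ 0)
    h.W_continuous.continuousOn (fun x _ ↦ (h.W_deriv x).hasDerivWithinAt) le_rfl
    (fun x ↦ hasDerivAt_const _ _) (fun x hx hWx ↦ ?_) (Set.right_mem_Icc.2 htt)
  have := (h.strictAntiOn_source hf hq).antitoneOn (Set.mem_Ici.2 ht.le)
    (Set.mem_Ici.2 (ht.le.trans hx.1)) hx.1
  rw [hWx, clip_of_nonpos hW.le]
  linarith

/-- At a level of at least `1` the square outweighs `-1` and the forcing is positive, so `W` can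
only cross upwards. -/
theorem le_of_one_le (h : IsTruncSol f q W S) (hf : IsDecayingForcing f) (hq : 0 ≤ q)
    {t₁ t : ℝ} (hW : 1 ≤ W t₁) (htt : t₁ ≤ t) : W t₁ ≤ W t := by
  have := image_le_of_deriv_right_lt_deriv_boundary (B := fun _ ↦ - W t₁) (B' := fun _ ↦ 0)
    (f := fun x ↦ - W x)
    h.W_continuous.neg.continuousOn (fun x _ ↦ (h.W_deriv x).neg.hasDerivWithinAt) le_rfl
    (fun x ↦ hasDerivAt_const _ _) (fun x hx hWx ↦ ?_) (Set.right_mem_Icc.2 htt)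
  · simpa using this
  · rw [neg_inj] at hWx
    have h1 := one_le_clip hW
    have h2 := momentum_nonneg hq (S x)
    have h3 := hf.pos x
    rw [hWx]
    nlinarith

theorem not_neg_and_one_lt (h : IsTruncSol f q W S) (hf : IsDecayingForcing f) (hq : 0 ≤ q)
    {t₁ t₂ : ℝ} (ht : 0 < t₁) (h1 : W t₁ < 0) (h2 : 1 < W t₂) : False := by
  rcases le_total t₁ t₂ with h12 | h12
  · linarith [h.le_of_neg hf hq ht h1 h12]
  · linarith [h.le_of_one_le hf hq h2.le h12]

/-- A solution which stays in `[0, 1]` has nonnegative derivative. -/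
theorem one_sub_source_le (h : IsTruncSol f q W S) (hf : IsDecayingForcing f) (hq : 0 ≤ q)
    (h0 : ∀ t ≥ 0, 0 ≤ W t) (h1 : ∀ t ≥ 0, W t ≤ 1) {t : ℝ} (ht : 0 ≤ t) :
    1 - (momentum q (S t) + f t) ≤ W t ^ 2 := by
  by_contra! hc
  set δ := 1 - (momentum q (S t) + f t) - W t ^ 2 with hδ
  have hδ0 : 0 < δ := by linarith
  -- The slope at `t` is `-δ`. While `W` is on the line of slope `-δ / 2`, neither `W²` nor the
  -- source exceeds its value at `t`, so the slope is still at most `-δ`.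
  have key (b : ℝ) (hb : t ≤ b) : W b ≤ W t - δ / 2 * (b - t) := by
    refine image_le_of_deriv_right_lt_deriv_boundary (B := fun x ↦ W t - δ / 2 * (x - t))
      (B' := fun _ ↦ -(δ / 2))
      h.W_continuous.continuousOn (fun x _ ↦ (h.W_deriv x).hasDerivWithinAt) (by simp)
      (fun x ↦ by simpa using (((hasDerivAt_id x).sub_const t).const_mul (δ / 2)).const_sub (W t))
      (fun x hx hWx ↦ ?_) (Set.right_mem_Icc.2 hb)
    have hx0 : 0 ≤ x := ht.trans hx.1
    have hs := (h.strictAntiOn_source hf hq).antitoneOn (Set.mem_Ici.2 ht)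
      (Set.mem_Ici.2 hx0) hx.1
    have hxt : W x ≤ W t := by
      rw [hWx]; nlinarith [hx.1]
    have hx2 := h0 x hx0
    rw [clip_of_mem hx2 ((h1 x hx0).trans (by norm_num))]
    nlinarith
  have h2 := key (t + 4 / δ) (by have := div_pos (by norm_num : (0 : ℝ) < 4) hδ0; linarith)
  have h3 := h0 (t + 4 / δ) (by positivity)
  have h4 : δ / 2 * (t + 4 / δ - t) = 2 := by field_simp; ring
  linarith [h1 t ht]

theorem W_monotoneOn (h : IsTruncSol f q W S) (hf : IsDecayingForcing f) (hq : 0 ≤ q)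
    (h0 : ∀ t ≥ 0, 0 ≤ W t) (h1 : ∀ t ≥ 0, W t ≤ 1) : MonotoneOn W (Set.Ici 0) := by
  refine monotoneOn_of_hasDerivWithinAt_nonneg (convex_Ici _) h.W_continuous.continuousOn
    (fun t _ ↦ (h.W_deriv t).hasDerivWithinAt) fun t ht ↦ ?_
  have ht : 0 ≤ t := interior_subset ht
  rw [clip_of_mem (h0 t ht) ((h1 t ht).trans (by norm_num))]
  linarith [h.one_sub_source_le hf hq h0 h1 ht]

theorem W_pos (h : IsTruncSol f q W S) (hf : IsDecayingForcing f) (hq : 0 ≤ q)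
    (h0 : ∀ t ≥ 0, 0 ≤ W t) (h1 : ∀ t ≥ 0, W t ≤ 1) {t : ℝ} (ht : 0 < t) : 0 < W t := by
  by_contra! hc
  have h2 := h.source_lt_one hf hq ht hc
  have h3 := h.one_sub_source_le hf hq h0 h1 ht.le
  have h4 : W t = 0 := le_antisymm hc (h0 t ht.le)
  rw [h4] at h3
  linarith

/-- By monotonicity `W ≥ W 1 > 0` after time `1`, so `S` grows at least linearly. -/
theorem tendsto_S (h : IsTruncSol f q W S) (hf : IsDecayingForcing f) (hq : 0 ≤ q)
    (h0 : ∀ t ≥ 0, 0 ≤ W t) (h1 : ∀ t ≥ 0, W t ≤ 1) : Tendsto S atTop atTop := by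
  have hm : 0 < W 1 := h.W_pos hf hq h0 h1 one_pos
  have key : ∀ t ≥ (1 : ℝ), W 1 * (t - 1) ≤ S t := fun t ht ↦ by
    have := (convex_Ici (1 : ℝ)).mul_sub_le_image_sub_of_le_deriv (f := S) (C := W 1)
      h.S_continuous.continuousOn (fun x _ ↦ (h.S_deriv x).differentiableAt.differentiableWithinAt)
      (fun x hx ↦ ?_) 1 Set.self_mem_Ici t ht ht
    · linarith [h.S_nonneg zero_le_one]
    · have hx : 1 ≤ x := interior_subset hx
      have hx0 : 0 ≤ x := zero_le_one.trans hx
      rw [(h.S_deriv x).deriv, clip_of_mem (h0 x hx0) ((h1 x hx0).trans (by norm_num))]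
      exact h.W_monotoneOn hf hq h0 h1 (Set.mem_Ici.2 zero_le_one) (Set.mem_Ici.2 hx0) hx
  refine tendsto_atTop_mono' _ (eventually_ge_atTop 1 |>.mono key) ?_
  exact (tendsto_atTop_add_const_right _ (-1) tendsto_id).const_mul_atTop hm

theorem tendsto_momentum (h : IsTruncSol f q W S) (hf : IsDecayingForcing f) (hq : 0 ≤ q)
    (h0 : ∀ t ≥ 0, 0 ≤ W t) (h1 : ∀ t ≥ 0, W t ≤ 1) :
    Tendsto (fun t ↦ momentum q (S t)) atTop (𝓝 0) := by
  have h2 : Tendsto (fun t ↦ max (S t) 0) atTop atTop :=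
    tendsto_atTop_mono (fun t ↦ le_max_left _ _) (h.tendsto_S hf hq h0 h1)
  have h3 := Real.tendsto_exp_atBot.comp (h2.const_mul_atTop_of_neg (by norm_num : (-2 : ℝ) < 0))
  simpa [momentum] using h3.const_mul q

/-- Squeeze: `1 - source ≤ W² ≤ W ≤ 1`, and the source tends to `0`. -/
theorem tendsto_W (h : IsTruncSol f q W S) (hf : IsDecayingForcing f) (hq : 0 ≤ q)
    (h0 : ∀ t ≥ 0, 0 ≤ W t) (h1 : ∀ t ≥ 0, W t ≤ 1) : Tendsto W atTop (𝓝 1) := by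
  have h2 := ((h.tendsto_momentum hf hq h0 h1).add hf.tendsto).const_sub 1
  rw [add_zero, sub_zero] at h2
  refine tendsto_of_tendsto_of_tendsto_of_le_of_le' h2 tendsto_const_nhds ?_ ?_
  · filter_upwards [eventually_ge_atTop 0] with t ht
    have := h.one_sub_source_le hf hq h0 h1 ht
    nlinarith [h0 t ht, h1 t ht]
  · filter_upwards [eventually_ge_atTop 0] with t ht using h1 t ht

end IsTruncSol

/-! ### Half orbits by shooting -/

/-- `(w, p)` is a solution on `[0, ∞)` of the forced system `w' = w² - 1 + p + f`, `p' = -2 w p`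
which issues from the symmetry line `w = 0` and tends to `(1, 0)`. -/
structure IsHalfOrbit (f w p : ℝ → ℝ) : Prop where
  w_zero : w 0 = 0
  w_deriv : ∀ t ≥ 0, HasDerivAt w (w t ^ 2 - 1 + p t + f t) t
  p_deriv : ∀ t ≥ 0, HasDerivAt p (-2 * w t * p t) t
  w_pos : ∀ t > 0, 0 < w t
  w_tendsto : Tendsto w atTop (𝓝 1)
  p_tendsto : Tendsto p atTop (𝓝 0)

theorem IsTruncSol.isHalfOrbit {f : ℝ → ℝ} {q : ℝ} {W S : ℝ → ℝ} (h : IsTruncSol f q W S)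
    (hf : IsDecayingForcing f) (hq : 0 ≤ q)
    (h0 : ∀ t ≥ 0, 0 ≤ W t) (h1 : ∀ t ≥ 0, W t ≤ 1) :
    IsHalfOrbit f W fun t ↦ q * Real.exp (-2 * S t) := by
  have hm (t : ℝ) (ht : 0 ≤ t) : momentum q (S t) = q * Real.exp (-2 * S t) := by
    rw [momentum, max_eq_left (h.S_nonneg ht)]
  have hc (t : ℝ) (ht : 0 ≤ t) : clip (W t) = W t :=
    clip_of_mem (h0 t ht) ((h1 t ht).trans (by norm_num))
  refine ⟨h.W_zero, fun t ht ↦ ?_, fun t ht ↦ ?_, fun t ht ↦ h.W_pos hf hq h0 h1 ht,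
    h.tendsto_W hf hq h0 h1, ?_⟩
  · simpa only [hm t ht, hc t ht] using h.W_deriv t
  · convert! (((h.S_deriv t).const_mul (-2)).exp.const_mul q) using 1
    rw [hc t ht]
    ring
  · refine (h.tendsto_momentum hf hq h0 h1).congr' ?_
    filter_upwards [eventually_ge_atTop 0] with t ht using hm t ht

/-- Grönwall: along a trajectory the fields for `q` and `q₀` differ by at most `|q - q₀|`. -/
theorem continuous_shooting {f : ℝ → ℝ} {W S : ℝ → ℝ → ℝ}
    (h : ∀ q, IsTruncSol f |q| (W q) (S q)) {t : ℝ} (ht : 0 ≤ t) :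
    Continuous fun q ↦ W q t := by
  refine continuous_iff_continuousAt.2 fun q₀ ↦ ?_
  set K := (4 + 2 * |q₀|).toNNReal
  have hd (q s : ℝ) : HasDerivAt (fun s ↦ (W q s, S q s)) (truncField f |q| s (W q s, S q s)) s :=
    ((h q).W_deriv s).prodMk ((h q).S_deriv s)
  have bound (q : ℝ) : dist (W q t) (W q₀ t) ≤ gronwallBound 0 K (|q - q₀| + 0) (t - 0) := by
    refine (le_max_left _ _).trans (dist_le_of_approx_trajectories_ODE
      (lipschitzWith_truncField f (abs_nonneg q₀))
      (fun s _ ↦ (hd q s).continuousAt.continuousWithinAt)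
      (fun s _ ↦ (hd q s).hasDerivWithinAt) (fun s _ ↦ ?_)
      (fun s _ ↦ (hd q₀ s).continuousAt.continuousWithinAt)
      (fun s _ ↦ (hd q₀ s).hasDerivWithinAt) (fun s _ ↦ (dist_self _).le) ?_ t
      (Set.right_mem_Icc.2 ht))
    · refine max_le ?_ (by simp [truncField])
      simp only [truncField, momentum, Real.dist_eq]
      rw [add_sub_add_right_eq_sub, add_sub_add_left_eq_sub, ← sub_mul, abs_mul, Real.abs_exp]
      have h1 : Real.exp (-2 * max (S q s) 0) ≤ 1 :=
        Real.exp_le_one_iff.2 (by linarith [le_max_right (S q s) 0])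
      exact (mul_le_of_le_one_right (abs_nonneg _) h1).trans (abs_abs_sub_abs_le _ _)
    · simp [(h q).W_zero, (h q).S_zero, (h q₀).W_zero, (h q₀).S_zero]
  have hlim : Tendsto (fun q ↦ gronwallBound 0 K (|q - q₀| + 0) (t - 0)) (𝓝 q₀) (𝓝 0) := by
    have h1 : Continuous fun q ↦ gronwallBound 0 K (|q - q₀| + 0) (t - 0) :=
      (gronwallBound_continuous_ε 0 K (t - 0)).comp (by fun_prop)
    simpa [gronwallBound_ε0_δ0] using h1.tendsto q₀
  exact tendsto_iff_dist_tendsto_zero.2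
    (squeeze_zero (fun _ ↦ dist_nonneg) bound hlim)

/-- On `[0, 1]` the drift satisfies `S ≤ 2`, so the momentum is at least `q e⁻⁴ ≥ 3` and `W' ≥ 2`.
-/
theorem IsTruncSol.one_lt_of_large {f : ℝ → ℝ} {q : ℝ} {W S : ℝ → ℝ} (h : IsTruncSol f q W S)
    (hf : IsDecayingForcing f) (hq : 3 * Real.exp 4 ≤ q) : 1 < W 1 := by
  have hq0 : 0 ≤ q := by linarith [Real.exp_pos 4]
  have hS (t : ℝ) (ht0 : 0 ≤ t) (ht1 : t ≤ 1) : S t ≤ 2 := by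
    have := (convex_Icc (0 : ℝ) 1).image_sub_le_mul_sub_of_deriv_le (f := S) (C := 2)
      h.S_continuous.continuousOn (fun x _ ↦ (h.S_deriv x).differentiableAt.differentiableWithinAt)
      (fun x _ ↦ (h.S_deriv x).deriv ▸ clip_le_two _) 0 (by simp) t ⟨ht0, ht1⟩ ht0
    rw [h.S_zero] at this
    linarith
  have := (convex_Icc (0 : ℝ) 1).mul_sub_le_image_sub_of_le_deriv (f := W) (C := 2)
    h.W_continuous.continuousOn (fun x _ ↦ (h.W_deriv x).differentiableAt.differentiableWithinAt)
    (fun x hx ↦ ?_) 0 (by simp) 1 (by simp) zero_le_one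
  · rw [h.W_zero] at this
    linarith
  · have hx := interior_subset hx
    rw [(h.W_deriv x).deriv]
    have h1 : momentum q 2 ≤ momentum q (S x) := momentum_antitone hq0 (hS x hx.1 hx.2)
    have h2 : momentum q 2 = q * Real.exp (-4) := by
      rw [momentum, max_eq_left zero_le_two]; norm_num
    have h3 : 3 * Real.exp 4 * Real.exp (-4) ≤ q * Real.exp (-4) := by gcongr
    rw [mul_assoc, ← Real.exp_add] at h3
    norm_num at h3
    nlinarith [hf.pos x, sq_nonneg (clip (W x))]

/-- Shooting in the initial momentum. -/
theorem IsDecayingForcing.exists_isHalfOrbit {f : ℝ → ℝ} (hf : IsDecayingForcing f)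
    (hneg : ∀ W S, IsTruncSol f 0 W S → ∃ t > 0, W t < 0) : ∃ w p, IsHalfOrbit f w p := by
  -- Using `|q|` keeps the momentum nonnegative while the parameter runs over the connected line
  -- `ℝ`.
  have hex (q : ℝ) := hf.exists_isTruncSol (abs_nonneg q)
  choose W S h using hex
  set A : Set ℝ := ⋃ t > (0 : ℝ), {q | W q t < 0}
  set B : Set ℝ := ⋃ t > (0 : ℝ), {q | 1 < W q t}
  have hA : IsOpen A := isOpen_biUnion fun t ht ↦
    isOpen_lt (continuous_shooting h (le_of_lt ht)) continuous_const
  have hB : IsOpen B := isOpen_biUnion fun t ht ↦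
    isOpen_lt continuous_const (continuous_shooting h (le_of_lt ht))
  have hA0 : (0 : ℝ) ∈ A := by
    obtain ⟨t, ht, hW⟩ := hneg _ _ (by simpa using h 0)
    exact Set.mem_biUnion (show t ∈ {t | t > 0} from ht) hW
  have hB0 : 3 * Real.exp 4 ∈ B :=
    Set.mem_biUnion (show (1 : ℝ) ∈ {t | t > 0} from one_pos (α := ℝ))
      ((h _).one_lt_of_large hf (le_abs_self _))
  have hdisj : ¬ (Set.univ ∩ (A ∩ B)).Nonempty := by
    rintro ⟨q, -, hqA, hqB⟩
    simp only [A, B, Set.mem_iUnion, Set.mem_ofPred_eq] at hqA hqB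
    obtain ⟨t₁, ht₁, h1⟩ := hqA
    obtain ⟨t₂, -, h2⟩ := hqB
    exact (h q).not_neg_and_one_lt hf (abs_nonneg q) ht₁ h1 h2
  have hcover : ¬ Set.univ ⊆ A ∪ B := fun hc ↦ hdisj
    (isPreconnected_univ A B hA hB hc ⟨0, trivial, hA0⟩ ⟨_, trivial, hB0⟩)
  obtain ⟨q, -, hq⟩ := Set.not_subset.1 hcover
  simp only [A, B, Set.mem_union, Set.mem_iUnion, Set.mem_ofPred_eq, not_or, not_exists,
    not_lt] at hq
  have ext0 (t : ℝ) (ht : 0 ≤ t) : 0 ≤ W q t ∧ W q t ≤ 1 := by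
    rcases ht.eq_or_lt with rfl | ht
    · simp [(h q).W_zero]
    · exact ⟨hq.1 t ht, hq.2 t ht⟩
  exact ⟨_, _, (h q).isHalfOrbit hf (abs_nonneg q) (fun t ht ↦ (ext0 t ht).1)
    fun t ht ↦ (ext0 t ht).2⟩

/-! ### The logistic forcing -/

/-- The heteroclinic solution of `y' = r y (3 - y)` with `y 0 = 3 / 2`. -/
noncomputable def logistic (r t : ℝ) : ℝ := 3 / (1 + Real.exp (-(3 * r * t)))

/-- The forcing `r y (3 - y)` along the logistic solution. -/
noncomputable def logisticForcing (r t : ℝ) : ℝ := r * logistic r t * (3 - logistic r t)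

theorem logistic_zero (r : ℝ) : logistic r 0 = 3 / 2 := by norm_num [logistic]

theorem logistic_pos (r t : ℝ) : 0 < logistic r t := by unfold logistic; positivity

theorem logistic_neg (r t : ℝ) : logistic r (-t) = 3 - logistic r t := by
  have h := Real.exp_pos (3 * r * t)
  rw [logistic, logistic, show -(3 * r * -t) = 3 * r * t by ring, Real.exp_neg]
  field_simp
  ring

theorem logistic_lt_three (r t : ℝ) : logistic r t < 3 := by
  linarith [logistic_neg r t, logistic_pos r (-t)]

theorem logisticForcing_neg (r t : ℝ) : logisticForcing r (-t) = logisticForcing r t := by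
  rw [logisticForcing, logisticForcing, logistic_neg]; ring

theorem hasDerivAt_logistic (r t : ℝ) : HasDerivAt (logistic r) (logisticForcing r t) t := by
  have h0 := Real.exp_pos (-(3 * r * t))
  have h1 : HasDerivAt (fun t ↦ 1 + Real.exp (-(3 * r * t)))
      (Real.exp (-(3 * r * t)) * (-(3 * r))) t := by
    simpa using (((hasDerivAt_id t).const_mul (3 * r)).neg.exp.const_add 1)
  have h2 := (hasDerivAt_const t (3 : ℝ)).div h1 (by positivity)
  convert! h2 using 1
  simp only [logisticForcing, logistic]
  field_simp
  ring

theorem continuous_logistic (r : ℝ) : Continuous (logistic r) :=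
  continuous_iff_continuousAt.2 fun t ↦ (hasDerivAt_logistic r t).continuousAt

theorem logisticForcing_pos {r : ℝ} (hr : 0 < r) (t : ℝ) : 0 < logisticForcing r t :=
  mul_pos (mul_pos hr (logistic_pos r t)) (sub_pos.2 (logistic_lt_three r t))

theorem strictMono_logistic {r : ℝ} (hr : 0 < r) : StrictMono (logistic r) :=
  strictMono_of_hasDerivAt_pos (hasDerivAt_logistic r) (logisticForcing_pos hr)

theorem tendsto_logistic_atTop {r : ℝ} (hr : 0 < r) : Tendsto (logistic r) atTop (𝓝 3) := by
  have h1 : Tendsto (fun t : ℝ ↦ 3 * r * t) atTop atTop :=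
    tendsto_id.const_mul_atTop (by positivity)
  have h2 := (Real.tendsto_exp_neg_atTop_nhds_zero.comp h1).const_add 1
  simpa [logistic] using! (tendsto_const_nhds (x := (3 : ℝ))).div h2 (by norm_num)

theorem tendsto_logistic_atBot {r : ℝ} (hr : 0 < r) : Tendsto (logistic r) atBot (𝓝 0) := by
  have h := ((tendsto_logistic_atTop hr).comp tendsto_neg_atBot_atTop).const_sub 3
  simpa [Function.comp_def, logistic_neg] using h

theorem isDecayingForcing_logisticForcing {r : ℝ} (hr : 0 < r) :
    IsDecayingForcing (logisticForcing r) where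
  continuous := by have := continuous_logistic r; unfold logisticForcing; fun_prop
  pos := logisticForcing_pos hr
  bounded := ⟨r * (9 / 4), fun t ↦ by
    rw [logisticForcing, mul_assoc]
    gcongr
    nlinarith [sq_nonneg (logistic r t - 3 / 2)]⟩
  strictAntiOn := fun a ha b _ hab ↦ by
    have h1 := strictMono_logistic hr hab
    have h2 := (strictMono_logistic hr).monotone (Set.mem_Ici.1 ha)
    rw [logistic_zero] at h2
    -- This product is `f a - f b`, with `f` the forcing.
    have h3 := mul_pos hr (mul_pos (sub_pos.2 h1)
      (by linarith : 0 < logistic r a + logistic r b - 3))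
    unfold logisticForcing
    linarith
  tendsto := by
    have h := tendsto_logistic_atTop hr
    simpa [logisticForcing] using! (h.const_mul r).mul (h.const_sub 3)

/-! ### Comparison with the critical profile -/

/-- The profile `2 y / 3 - 1`, which for `p = 0` is a supersolution of the reduced equation when
`r ≤ 4 / 3` and a solution when `r = 4 / 3`. -/
noncomputable def profile (r t : ℝ) : ℝ := 2 / 3 * logistic r t - 1

theorem hasDerivAt_profile (r t : ℝ) :
    HasDerivAt (profile r) (2 / 3 * logisticForcing r t) t :=
  ((hasDerivAt_logistic r t).const_mul (2 / 3)).sub_const 1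

theorem profile_zero (r : ℝ) : profile r 0 = 0 := by norm_num [profile, logistic_zero]

theorem profile_lt_one (r t : ℝ) : profile r t < 1 := by
  linarith [logistic_lt_three r t, show profile r t = 2 / 3 * logistic r t - 1 from rfl]

theorem strictMono_profile {r : ℝ} (hr : 0 < r) : StrictMono (profile r) := fun a b h ↦ by
  have := strictMono_logistic hr h
  unfold profile
  linarith

theorem profile_sq (r t : ℝ) :
    r * (profile r t ^ 2 - 1) = -(4 / 9) * logisticForcing r t := by
  unfold profile logisticForcing
  ring

/-- By `profile_sq` the left side is `(1 - 4 / (9r)) f`, and `1 - 4 / (9r) < 2 / 3` exactly when `r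
< 4 / 3`. -/
theorem profile_defect_pos {r : ℝ} (hr : 0 < r) (hrc : r < 4 / 3) (t : ℝ) :
    profile r t ^ 2 - 1 + logisticForcing r t < 2 / 3 * logisticForcing r t := by
  have h1 := profile_sq r t
  have h2 := logisticForcing_pos hr t
  by_contra! h3
  nlinarith [mul_le_mul_of_nonneg_left h3 hr.le, mul_pos h2 (sub_pos.2 hrc)]

/-- Below the critical rate, the solution with zero momentum turns negative. -/
theorem IsTruncSol.exists_neg {r : ℝ} (hr : 0 < r) (hrc : r < 4 / 3) {W S : ℝ → ℝ}
    (h : IsTruncSol (logisticForcing r) 0 W S) : ∃ t > 0, W t < 0 := by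
  by_contra! h0
  have hW0 (t : ℝ) (ht : 0 ≤ t) : 0 ≤ W t := by
    rcases ht.eq_or_lt with rfl | ht
    · exact h.W_zero.ge
    · exact h0 t ht
  have hv0 (t : ℝ) (ht : 0 ≤ t) : 0 ≤ profile r t :=
    profile_zero r ▸ (strictMono_profile hr).monotone ht
  have hd (t : ℝ) : HasDerivAt W (clip (W t) ^ 2 - 1 + logisticForcing r t) t := by
    simpa [momentum] using h.W_deriv t
  have hle (t : ℝ) (ht : 0 ≤ t) : W t ≤ profile r t := by
    refine image_le_of_deriv_right_lt_deriv_boundary (a := 0) (B := profile r)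
      h.W_continuous.continuousOn (fun x _ ↦ (hd x).hasDerivWithinAt)
      (by rw [h.W_zero, profile_zero]) (hasDerivAt_profile r)
      (fun x hx hWx ↦ ?_) (Set.right_mem_Icc.2 ht)
    rw [hWx, clip_of_mem (hv0 x hx.1) ((profile_lt_one r x).le.trans (by norm_num))]
    exact profile_defect_pos hr hrc x
  -- With `v` the profile, the gap satisfies `d' > v² - W² = (v + W) d ≥ v d`. It thus grows at
  -- least linearly after time `1`, yet `d ≤ v < 1`.
  set d : ℝ → ℝ := fun t ↦ profile r t - W t with hdef
  have hdd (t : ℝ) : HasDerivAt d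
      (2 / 3 * logisticForcing r t - (clip (W t) ^ 2 - 1 + logisticForcing r t)) t :=
    (hasDerivAt_profile r t).sub (hd t)
  have hdpos (t : ℝ) (ht : 0 ≤ t) : profile r t * d t <
      2 / 3 * logisticForcing r t - (clip (W t) ^ 2 - 1 + logisticForcing r t) := by
    rw [clip_of_mem (hW0 t ht) (by linarith [hle t ht, profile_lt_one r t])]
    nlinarith [profile_defect_pos hr hrc t, hle t ht, hW0 t ht, hv0 t ht,
      mul_nonneg (hW0 t ht) (sub_nonneg.2 (hle t ht))]
  have hdc : Continuous d := continuous_iff_continuousAt.2 fun t ↦ (hdd t).continuousAt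
  have hmono : StrictMonoOn d (Set.Ici 0) := by
    refine strictMonoOn_of_hasDerivWithinAt_pos (convex_Ici _) hdc.continuousOn
      (fun t _ ↦ (hdd t).hasDerivWithinAt) fun t ht ↦ ?_
    have ht : 0 ≤ t := interior_subset ht
    exact (mul_nonneg (hv0 t ht) (sub_nonneg.2 (hle t ht))).trans_lt (hdpos t ht)
  have hd1 : 0 < d 1 := by
    have := hmono (Set.mem_Ici.2 le_rfl) (Set.mem_Ici.2 zero_le_one) one_pos
    simpa [hdef, h.W_zero, profile_zero] using this
  have hv1 : 0 < profile r 1 := profile_zero r ▸ strictMono_profile hr one_pos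
  have hm := mul_pos hv1 hd1
  set m := profile r 1 * d 1
  -- In time `1 / m` the gap grows by at least `1`.
  have hT : 1 ≤ 1 + 1 / m := by have := one_div_pos.2 hm; linarith
  have := (convex_Ici (1 : ℝ)).mul_sub_le_image_sub_of_le_deriv (f := d) (C := m)
    hdc.continuousOn (fun x _ ↦ (hdd x).differentiableAt.differentiableWithinAt)
    (fun x hx ↦ ?_) 1 Set.self_mem_Ici (1 + 1 / m) hT hT
  · rw [add_sub_cancel_left, mul_one_div_cancel hm.ne'] at this
    have h2 := profile_lt_one r (1 + 1 / m)
    have h3 := hW0 (1 + 1 / m) (by linarith)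
    simp only [hdef] at this hd1
    linarith
  · have hx : 1 ≤ x := interior_subset hx
    have hx0 : 0 ≤ x := zero_le_one.trans hx
    rw [(hdd x).deriv]
    refine le_trans ?_ (hdpos x hx0).le
    exact mul_le_mul ((strictMono_profile hr).monotone hx)
      (hmono.monotoneOn (Set.mem_Ici.2 zero_le_one) (Set.mem_Ici.2 hx0) hx) hd1.le (hv0 x hx0)

theorem isHalfOrbit_profile : IsHalfOrbit (logisticForcing (4 / 3)) (profile (4 / 3)) 0 where
  w_zero := profile_zero _
  w_deriv := fun t _ ↦ by
    convert! hasDerivAt_profile (4 / 3) t using 1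
    have := profile_sq (4 / 3) t
    simp only [Pi.zero_apply]
    linarith
  p_deriv := fun t _ ↦ by simp
  w_pos := fun t ht ↦ profile_zero (4 / 3) ▸ strictMono_profile (by norm_num) ht
  w_tendsto := by
    have := ((tendsto_logistic_atTop (r := 4 / 3) (by norm_num)).const_mul (2 / 3)).sub_const 1
    norm_num at this
    exact this
  p_tendsto := tendsto_const_nhds

/-- At `r = 4 / 3` the zero-momentum solution never turns negative, so shooting lacks its lower end
and the explicit orbit replaces it. -/
theorem exists_isHalfOrbit_logisticForcing {r : ℝ} (hr : 0 < r) (hrc : r ≤ 4 / 3) :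
    ∃ w p, IsHalfOrbit (logisticForcing r) w p := by
  rcases hrc.eq_or_lt with rfl | hrc
  · exact ⟨_, _, isHalfOrbit_profile⟩
  · exact (isDecayingForcing_logisticForcing hr).exists_isHalfOrbit
      fun W S h ↦ h.exists_neg hr hrc

/-! ### Reflection to a full orbit -/

theorem hasDerivAt_ite_zero_le {g h g' h' : ℝ → ℝ} (hg : ∀ t ≥ 0, HasDerivAt g (g' t) t)
    (hh : ∀ t ≤ 0, HasDerivAt h (h' t) t) (h0 : g 0 = h 0) (h0' : g' 0 = h' 0) (t : ℝ) :
    HasDerivAt (fun s ↦ if 0 ≤ s then g s else h s) (if 0 ≤ t then g' t else h' t) t := by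
  rcases lt_trichotomy t 0 with ht | rfl | ht
  · rw [if_neg ht.not_ge]
    refine (hh t ht.le).congr_of_eventuallyEq ?_
    filter_upwards [Iio_mem_nhds ht] with s hs using if_neg (not_le.2 hs)
  · rw [if_pos le_rfl, ← hasDerivWithinAt_univ, ← Set.Iic_union_Ici (a := (0 : ℝ))]
    refine HasDerivWithinAt.union ?_ ?_
    · rw [h0']
      refine (hh 0 le_rfl).hasDerivWithinAt.congr (fun s hs ↦ ?_) (by simp [h0])
      rcases (Set.mem_Iic.1 hs).eq_or_lt with rfl | hs
      · simp [h0]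
      · exact if_neg hs.not_ge
    · exact (hg 0 le_rfl).hasDerivWithinAt.congr (fun s hs ↦ if_pos hs) (if_pos le_rfl)
  · rw [if_pos ht.le]
    refine (hg t ht.le).congr_of_eventuallyEq ?_
    filter_upwards [Ioi_mem_nhds ht] with s hs using if_pos (le_of_lt hs)

/-- `(w, p)` is a solution on `ℝ` of the forced system, symmetric under `(w, t) ↦ (-w, -t)` and
connecting `(-1, 0)` to `(1, 0)`. -/
structure IsFullOrbit (f w p : ℝ → ℝ) : Prop where
  w_zero : w 0 = 0
  w_deriv : ∀ t, HasDerivAt w (w t ^ 2 - 1 + p t + f t) t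
  p_deriv : ∀ t, HasDerivAt p (-2 * w t * p t) t
  w_pos : ∀ t > 0, 0 < w t
  w_neg : ∀ t < 0, w t < 0
  w_atTop : Tendsto w atTop (𝓝 1)
  p_atTop : Tendsto p atTop (𝓝 0)
  w_atBot : Tendsto w atBot (𝓝 (-1))
  p_atBot : Tendsto p atBot (𝓝 0)

/-- The reflected half solves the same system because `f` is even; values and slopes match at `0`
because `w 0 = 0`. -/
theorem IsHalfOrbit.isFullOrbit {f w p : ℝ → ℝ} (h : IsHalfOrbit f w p)
    (hf : ∀ t, f (-t) = f t) :
    IsFullOrbit f (fun t ↦ if 0 ≤ t then w t else -w (-t))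
      (fun t ↦ if 0 ≤ t then p t else p (-t)) where
  w_zero := by simp [h.w_zero]
  w_deriv := fun t ↦ by
    convert! hasDerivAt_ite_zero_le (g := w) (h := fun t ↦ -w (-t))
      (g' := fun t ↦ w t ^ 2 - 1 + p t + f t)
      (h' := fun t ↦ w (-t) ^ 2 - 1 + p (-t) + f t) h.w_deriv (fun s hs ↦ ?_)
      (by simp [h.w_zero]) (by simp) t using 1
    · split_ifs <;> simp
    · simpa [hf, Function.comp_def] using!
        ((h.w_deriv (-s) (neg_nonneg.2 hs)).comp s (hasDerivAt_neg s)).neg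
  p_deriv := fun t ↦ by
    convert! hasDerivAt_ite_zero_le (g := p) (h := fun t ↦ p (-t))
      (g' := fun t ↦ -2 * w t * p t)
      (h' := fun t ↦ 2 * w (-t) * p (-t)) h.p_deriv (fun s hs ↦ ?_)
      (by simp) (by simp [h.w_zero]) t using 1
    · split_ifs <;> ring
    · simpa [Function.comp_def] using
        ((h.p_deriv (-s) (neg_nonneg.2 hs)).comp s (hasDerivAt_neg s))
  w_pos := fun t ht ↦ by simpa [ht.le] using h.w_pos t ht
  w_neg := fun t ht ↦ by simpa [ht.not_ge] using h.w_pos (-t) (neg_pos.2 ht)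
  w_atTop := h.w_tendsto.congr' <| by
    filter_upwards [eventually_ge_atTop 0] with t ht using (if_pos ht).symm
  p_atTop := h.p_tendsto.congr' <| by
    filter_upwards [eventually_ge_atTop 0] with t ht using (if_pos ht).symm
  w_atBot := (h.w_tendsto.comp tendsto_neg_atBot_atTop).neg.congr' <| by
    filter_upwards [eventually_lt_atBot 0] with t ht using (if_neg ht.not_ge).symm
  p_atBot := (h.p_tendsto.comp tendsto_neg_atBot_atTop).congr' <| by
    filter_upwards [eventually_lt_atBot 0] with t ht using (if_neg ht.not_ge).symm

/-! ### Saddles and the heteroclinic orbit -/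

/-- The Jacobian matrix of `mppField r σ₁` at a point with `p = 0`. -/
def mppJacobian (r σ₁ μ y : ℝ) : Matrix (Fin 3) (Fin 3) ℝ :=
  !![2 * μ, σ₁ ^ 2, 2 * μ; 0, -2 * μ, 0; 0, 0, r * (3 - 2 * y)]

theorem hasFDerivAt_mppField (r σ₁ : ℝ) {a : Fin 3 → ℝ} (ha : a 1 = 0) :
    HasFDerivAt (mppField r σ₁)
      (Matrix.toLin' (mppJacobian r σ₁ (a 0 + a 2) (a 2))).toContinuousLinearMap a := by
  have h (i : Fin 3) : HasFDerivAt (fun v : Fin 3 → ℝ ↦ v i)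
      (ContinuousLinearMap.proj (R := ℝ) (φ := fun _ : Fin 3 ↦ ℝ) i) a := hasFDerivAt_apply i a
  rw [hasFDerivAt_pi']
  intro i
  fin_cases i
  · convert! ((((h 0).add (h 2)).pow 2).sub_const 1).add ((h 1).const_mul (σ₁ ^ 2)) using 1
    ext v
    simp [mppJacobian, dotProduct, Fin.sum_univ_three]
    ring
  · convert! (((h 0).add (h 2)).const_mul (-2)).mul (h 1) using 1
    ext v
    simp [mppJacobian, dotProduct, Fin.sum_univ_three, ha]
  · convert! ((h 2).const_mul r).mul ((h 2).const_sub 3) using 1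
    ext v
    simp [mppJacobian, dotProduct, Fin.sum_univ_three]
    ring

/-- At `p = 0` the Jacobian is upper triangular with diagonal `2μ, -2μ, r(3 - 2y)`, here `±2, ∓2,
±3r`. -/
theorem isSaddle_mppField {r σ₁ : ℝ} (hr : 0 < r) {a : Fin 3 → ℝ} (h1 : a 1 = 0)
    (hμ : (a 0 + a 2) ^ 2 = 1) (hy : a 2 = 0 ∨ a 2 = 3) : IsSaddle (mppField r σ₁) a := by
  have hd := hasFDerivAt_mppField r σ₁ h1
  set μ := a 0 + a 2 with hμdef
  have hroots (z : ℂ) : z ∈ (fderiv ℝ (mppField r σ₁) a).toLinearMap.charpoly.aroots ℂ ↔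
      z = ((2 * μ : ℝ) : ℂ) ∨ z = ((-2 * μ : ℝ) : ℂ) ∨ z = ((r * (3 - 2 * a 2) : ℝ) : ℂ) := by
    have htri : (mppJacobian r σ₁ μ (a 2)).IsUpperTriangular := by
      intro i j hij
      fin_cases i <;> fin_cases j <;> simp_all [mppJacobian]
    rw [hd.fderiv, LinearMap.coe_toContinuousLinearMap, Matrix.charpoly_toLin',
      Matrix.charpoly_of_isUpperTriangular _ htri, Polynomial.mem_aroots,
      and_iff_right (Polynomial.monic_prod_X_sub_C _ _).ne_zero]
    simp only [Fin.prod_univ_three, map_mul, map_sub,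
      Polynomial.aeval_X, Polynomial.aeval_C, mul_eq_zero, sub_eq_zero, or_assoc]
    rfl
  have hμ' : μ = 1 ∨ μ = -1 := by
    rcases eq_or_ne μ 1 with h | h
    · exact Or.inl h
    · exact Or.inr (mul_left_cancel₀ (sub_ne_zero.2 h) (by linear_combination hμ))
  refine ⟨?_, hd.differentiableAt, fun z hz ↦ ?_, ?_, ?_⟩
  · ext i
    fin_cases i
    · simp [mppField, ← hμdef, hμ, h1]
    · simp [mppField, h1]
    · rcases hy with h | h <;> simp [mppField, h]
  · rcases (hroots z).1 hz with rfl | rfl | rfl <;> rw [Complex.ofReal_re]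
    · rcases hμ' with h | h <;> norm_num [h]
    · rcases hμ' with h | h <;> norm_num [h]
    · rcases hy with h | h <;> norm_num [h, hr.ne']
  · rcases hμ' with h | h
    · exact ⟨_, (hroots _).2 (Or.inr (Or.inl rfl)), by rw [Complex.ofReal_re, h]; norm_num⟩
    · exact ⟨_, (hroots _).2 (Or.inl rfl), by rw [Complex.ofReal_re, h]; norm_num⟩
  · rcases hμ' with h | h
    · exact ⟨_, (hroots _).2 (Or.inl rfl), by rw [Complex.ofReal_re, h]; norm_num⟩
    · exact ⟨_, (hroots _).2 (Or.inr (Or.inl rfl)), by rw [Complex.ofReal_re, h]; norm_num⟩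

theorem isSaddle_left {r : ℝ} (hr : 0 < r) (σ₁ : ℝ) :
    IsSaddle (mppField r σ₁) ![-1, 0, 0] :=
  isSaddle_mppField hr rfl (show ((-1 : ℝ) + 0) ^ 2 = 1 by norm_num) (Or.inl rfl)

theorem isSaddle_right {r : ℝ} (hr : 0 < r) (σ₁ : ℝ) :
    IsSaddle (mppField r σ₁) ![-2, 0, 3] :=
  isSaddle_mppField hr rfl (show ((-2 : ℝ) + 3) ^ 2 = 1 by norm_num) (Or.inr rfl)

/-- A symmetric orbit of the forced system lifts to a heteroclinic orbit of `mppField`. -/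
theorem IsFullOrbit.isHeteroclinicOrbit {r σ₁ : ℝ} (hr : 0 < r) (hσ : σ₁ ≠ 0) {w p : ℝ → ℝ}
    (h : IsFullOrbit (logisticForcing r) w p) :
    IsHeteroclinicOrbit (mppField r σ₁) ![-1, 0, 0] ![-2, 0, 3]
      fun t ↦ ![w t - logistic r t, p t / σ₁ ^ 2, logistic r t] where
  ne := fun he ↦ by simpa using congrFun he 2
  left_equilibrium := (isSaddle_left hr σ₁).equilibrium
  right_equilibrium := (isSaddle_right hr σ₁).equilibrium
  solution := fun t ↦ by
    rw [hasDerivAt_pi]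
    intro i
    fin_cases i
    · convert! (h.w_deriv t).sub (hasDerivAt_logistic r t) using 1
      simp [mppField]
      field_simp
    · convert! (h.p_deriv t).div_const (σ₁ ^ 2) using 1
      simp [mppField]
      ring
    · exact hasDerivAt_logistic r t
  tendsto_left := by
    rw [tendsto_pi_nhds]
    intro i
    fin_cases i
    · simpa using h.w_atBot.sub (tendsto_logistic_atBot hr)
    · simpa using h.p_atBot.div_const (σ₁ ^ 2)
    · simpa using tendsto_logistic_atBot hr
  tendsto_right := by
    rw [tendsto_pi_nhds]
    intro i
    fin_cases i
    · have := h.w_atTop.sub (tendsto_logistic_atTop hr)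
      norm_num at this
      simpa using this
    · simpa using h.p_atTop.div_const (σ₁ ^ 2)
    · simpa using tendsto_logistic_atTop hr

theorem theorem1 (r σ₁ : ℝ) (hr : 0 < r) (hrc : r ≤ 4 / 3) (hσ : 0 < σ₁) :
    IsSaddle (mppField r σ₁) ![-1, 0, 0] ∧
    IsSaddle (mppField r σ₁) ![-2, 0, 3] ∧
    ∃ γ : ℝ → (Fin 3 → ℝ),
      IsHeteroclinicOrbit (mppField r σ₁) ![-1, 0, 0] ![-2, 0, 3] γ ∧
      ∃ t₀ : ℝ, γ t₀ 2 = -γ t₀ 0 ∧ γ t₀ 2 = 3 / 2 ∧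
        (∀ t < t₀, γ t 0 + γ t 2 < 0) ∧ (∀ t > t₀, 0 < γ t 0 + γ t 2) := by
  refine ⟨isSaddle_left hr σ₁, isSaddle_right hr σ₁, ?_⟩
  obtain ⟨w, p, h⟩ := exists_isHalfOrbit_logisticForcing hr hrc
  have hF := h.isFullOrbit (logisticForcing_neg r)
  refine ⟨_, hF.isHeteroclinicOrbit hr hσ.ne', 0, ?_, ?_, fun t ht ↦ ?_, fun t ht ↦ ?_⟩
  · simp [h.w_zero]
  · simp [logistic_zero]
  · simpa using hF.w_neg t ht
  · simpa using hF.w_pos t ht
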